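/- Let $\sigma(t)=\max(t,0)$ and let $B$ be the Beta function. For $d,m\ge 1$ let $W=W_{(m)}\in\mathbb R^{d\times m}$ be a random matrix with i.i.d. $N(0,1/m)$ entries, let $W^{(i)}$ be its $i$-th column, and write $W^{(i)}_k$ for the $k$-th coordinate of $W^{(i)}$. For $x\in\mathbb R^d$ let $X=\sigma(x^\top W)\in\mathbb R^m$ ($\sigma$ applied componentwise), and define vectors in $\mathbb R^m$ by $$v^{(0)}_i=\frac{\|W^{(i)}\|}{\sqrt d},\qquad v^{(\gamma,\gamma)}_i=\sqrt{d+2}\,\frac{(W^{(i)}_\gamma)^2}{\|W^{(i)}\|},\qquad \tilde v^{(\gamma)}=\frac1{\sqrt2}\Bigl(v^{(\gamma,\gamma)}-\sqrt{\tfrac{d+2}{d}}\,v^{(0)}\Bigr)\quad(1\le\gamma\le d),$$ $$v^{(\gamma)}=\tilde v^{(\gamma)}-\frac1{\sqrt d+1}\,\tilde v^{(d)}\quad(1\le\gamma\le d-1).$$ For $x\ne0$ put $r_\gamma=x_\gamma^2/\|x\|^2$, and let $x_{-\gamma}$ denote $x$ with its $\gamma$-th component removed. Below, $\xrightarrow{p}$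 is convergence in probability as $m\to\infty$ with $d$ and $x$ fixed. **Theorem.** There is an absolute constant $C$ such that for every $d\ge 6$ there are functions $h_\gamma(s,r)$, $1\le\gamma\le d$, depending only on $d$ and $\gamma$, with $$|h_\gamma(s,r)|\le C\,r^2 s\qquad\text{for all } s>0,\ 0\le r\le1,$$ such that for every $x\in\mathbb R^d\setminus\{0\}$ the following hold. 1. For every $1\le\gamma\le d$, $$X^\top\tilde v^{(\gamma)}\xrightarrow{p}\begin{cases}\dfrac{(d-1)\sqrt{d+2}}{2\pi(d+1)\sqrt2}\,B\bigl(\tfrac d2,\tfrac12\bigr)\|x\| & \text{if } x_{-\gamma}=0,\\[2mm] -\dfrac{\sqrt{d+2}}{2\pi(d+1)\sqrt2}\,B\bigl(\tfrac d2,\tfrac12\bigr)\|x\| & \text{if } x_\gamma=0,\\[2mm] \dfrac{d\sqrt{d+2}}{2\pi(d+1)\sqrt2}\,B\bigl(\tfrac d2,\tfrac12\bigr)\|x\|\Bigl(r_\gamma-\dfrac1d\Bigr)+h_\gamma(\|x\|,r_\gamma)&\text{otherwise.}\end{cases}$$ 2. For every $1\le\gamma\le d-1$, $$X^\top v^{(\gamma)}\xrightarrow{p}\frac{d\sqrt{d+2}}{2\pi(d+1)\sqrt2}\,B\bigl(\tfrac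 d2,\tfrac12\bigr)\|x\|\Bigl(r_\gamma-\frac{r_d}{\sqrt d+1}-\frac1{d+\sqrt d}\Bigr)+h_\gamma(\|x\|,r_\gamma)-\frac1{\sqrt d+1}\,h_d(\|x\|,r_d).$$ -/

import Mathlib

open MeasureTheory ProbabilityTheory Filter
open scoped NNReal Matrix

namespace ReluFeature

noncomputable section

/-- The ReLU function. -/
def relu (t : ℝ) : ℝ := max t 0

/-- The Euclidean norm `‖W⁽ⁱ⁾‖` of the `i`-th column of the `d × m` matrix `W`. -/
def colNorm {d m : ℕ} (W : Matrix (Fin d) (Fin m) ℝ) (i : Fin m) : ℝ :=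
  ‖(WithLp.toLp 2 (fun k => W k i) : EuclideanSpace ℝ (Fin d))‖

/-- The activated covariate `X = σ(xᵀ W)`, the ReLU being applied componentwise. -/
def covariate {d m : ℕ} (W : Matrix (Fin d) (Fin m) ℝ) (x : EuclideanSpace ℝ (Fin d)) :
    Fin m → ℝ :=
  fun i => relu ((x.ofLp ᵥ* W) i)

/-- The network function `f_v(x) = Xᵀ v`. -/
def network {d m : ℕ} (W : Matrix (Fin d) (Fin m) ℝ) (x : EuclideanSpace ℝ (Fin d))
    (v : Fin m → ℝ) : ℝ :=
  covariate W x ⬝ᵥ v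

/-- The first-group vector `v⁽⁰⁾`, with components `‖W⁽ⁱ⁾‖ / √d`. -/
def vecZero {d m : ℕ} (W : Matrix (Fin d) (Fin m) ℝ) : Fin m → ℝ :=
  fun i => colNorm W i / √(d : ℝ)

/-- The vector `v⁽ᵅ'ᵝ⁾`, with components `√(d+2) W_α⁽ⁱ⁾ W_β⁽ⁱ⁾ / ‖W⁽ⁱ⁾‖`. -/
def vecPair {d m : ℕ} (W : Matrix (Fin d) (Fin m) ℝ) (α β : Fin d) : Fin m → ℝ :=
  fun i => √((d : ℝ) + 2) * (W α i * W β i / colNorm W i)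

/-- The vector `ṽ⁽ᵞ⁾ = (v⁽ᵞ'ᵞ⁾ - √((d+2)/d) v⁽⁰⁾) / √2`. -/
def vecTilde {d m : ℕ} (W : Matrix (Fin d) (Fin m) ℝ) (γ : Fin d) : Fin m → ℝ :=
  (1 / √(2 : ℝ)) • (vecPair W γ γ - √(((d : ℝ) + 2) / d) • vecZero W)

/-- The last coordinate of a nonempty index set (the index `d` in one-based numbering). -/
def lastIdx {d : ℕ} (hd : 0 < d) : Fin d := ⟨d - 1, Nat.sub_lt hd Nat.one_pos⟩

/-- The third-group vector `v⁽ᵞ⁾ = ṽ⁽ᵞ⁾ - ṽ⁽ᵈ⁾ / (√d + 1)`. -/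
def vecThird {d m : ℕ} (hd : 0 < d) (W : Matrix (Fin d) (Fin m) ℝ) (γ : Fin d) : Fin m → ℝ :=
  vecTilde W γ - (1 / (√(d : ℝ) + 1)) • vecTilde W (lastIdx hd)

/-- The ratio `r_γ = x_γ² / ‖x‖²`. -/
def ratio {d : ℕ} (x : EuclideanSpace ℝ (Fin d)) (γ : Fin d) : ℝ := x γ ^ 2 / ‖x‖ ^ 2

/-- `W` is a random `d × m` matrix whose entries are independent with law `N(0, 1/m)`. -/
structure IsGaussianInit {Ω : Type*} [MeasurableSpace Ω] (P : Measure Ω) {d m : ℕ}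
    (W : Ω → Matrix (Fin d) (Fin m) ℝ) : Prop where
  law : ∀ k i, HasLaw (fun ω => W ω k i) (gaussianReal 0 ((m : ℝ≥0)⁻¹)) P
  indep : iIndepFun (fun (p : Fin d × Fin m) ω => W ω p.1 p.2) P

end

end ReluFeature

open ReluFeature

/-! Scaled by `√m`, each column of `W` becomes a standard Gaussian vector `g` in `ℝᵈ`. The
contribution of one column to `Xᵀ ṽ⁽ᵞ⁾` is positively homogeneous of degree 2, so the sum over
columns is an average of independent copies of `tildeSummand x γ g`. Chebyshev's inequality makes it
converge to the expectation (`tendstoInMeasure_sum_colVec`).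

That expectation is computed exactly. The summand is a constant times `φ(g) / ‖g‖`, where `φ(g) =
relu ⟪x, g⟫ (g_γ² - ‖g‖² / d)` has degree 3. In polar coordinates the division by `‖g‖` alters only
the radial integral, which costs a quotient of Gamma values (`integral_stdGaussian_div_norm`),
rewritten through `B(d/2, 1/2)` in `gamma_ratio_eq_beta`. The expectation of `φ` follows by
splitting a coordinate vector along `x` and orthogonally to it, the two Gaussian parts being
independent (`integral_relu_inner_mul_inner_sq`); it is proportional to `‖x‖ (r_γ - 1/d)`.

Hence the limit is affine in `r_γ` with no remainder: the first two cases of the theorem are its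
values at `r_γ = 1` and `r_γ = 0`, and zero correction terms suffice. -/

namespace ReluFeature

/-! ### Lebesgue density of the standard Gaussian measure. -/

section Density

variable {E : Type*} [NormedAddCommGroup E] [InnerProductSpace ℝ E]

/-- The density of the standard Gaussian measure on a Euclidean space. -/
noncomputable def stdGaussianDensity (E : Type*) [NormedAddCommGroup E] [InnerProductSpace ℝ E]
    (x : E) : ℝ≥0 :=
  Real.toNNReal ((2 * Real.pi) ^ (-(Module.finrank ℝ E : ℝ) / 2)) *
    Real.toNNReal (Real.exp (-(1 / 2) * ‖x‖ ^ 2))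

lemma coe_stdGaussianDensity (x : E) :
    (stdGaussianDensity E x : ℝ) =
      (2 * Real.pi) ^ (-(Module.finrank ℝ E : ℝ) / 2) * Real.exp (-(1 / 2) * ‖x‖ ^ 2) := by
  rw [stdGaussianDensity, NNReal.coe_mul, Real.coe_toNNReal _ (by positivity),
    Real.coe_toNNReal _ (by positivity)]

variable [MeasurableSpace E] [BorelSpace E]

lemma measurable_stdGaussianDensity : Measurable (stdGaussianDensity E) := by
  unfold stdGaussianDensity
  fun_prop

variable [FiniteDimensional ℝ E]

lemma integrable_exp_neg_half_sq_norm :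
    Integrable (fun x : E => Real.exp (-(1 / 2) * ‖x‖ ^ 2)) := by
  have h := (GaussianFourier.integrable_cexp_neg_mul_sq_norm_add (V := E) (b := 1 / 2)
    (by norm_num) 0 0).re
  refine h.congr (ae_of_all _ fun x => ?_)
  have : (-(1 / 2 : ℂ) * (‖x‖ : ℂ) ^ 2 + 0 * ((inner ℝ (0 : E) x : ℝ) : ℂ))
      = ((-(1 / 2) * ‖x‖ ^ 2 : ℝ) : ℂ) := by push_cast; ring
  simp only [this]
  exact Complex.exp_ofReal_re _

/-- Both sides are finite measures with the same characteristic function. The density is what gives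
access to polar coordinates. -/
lemma stdGaussian_eq_withDensity :
    stdGaussian E = volume.withDensity (fun x => (stdGaussianDensity E x : ENNReal)) := by
  have hfin : IsFiniteMeasure
      (volume.withDensity (fun x : E => (stdGaussianDensity E x : ENNReal))) := by
    have hi : Integrable (fun x : E => (stdGaussianDensity E x : ℝ)) := by
      simp_rw [coe_stdGaussianDensity]
      exact integrable_exp_neg_half_sq_norm.const_mul _
    have := isFiniteMeasure_withDensity_ofReal hi.2
    simpa using this
  refine Measure.ext_of_charFun ?_
  ext t
  rw [charFun_stdGaussian, charFun_apply,
    integral_withDensity_eq_integral_smul measurable_stdGaussianDensity]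
  have h := GaussianFourier.integral_cexp_neg_mul_sq_norm_add (V := E) (b := 1 / 2)
    (by norm_num) Complex.I t
  have hcongr : ∀ x : E, stdGaussianDensity E x • Complex.exp ((inner ℝ x t : ℝ) * Complex.I)
      = (((2 * Real.pi) ^ (-(Module.finrank ℝ E : ℝ) / 2) : ℝ) : ℂ) *
        Complex.exp (-(1 / 2) * (‖x‖ : ℂ) ^ 2 + Complex.I * (inner ℝ t x : ℝ)) := by
    intro x
    rw [NNReal.smul_def, coe_stdGaussianDensity, Complex.real_smul, Complex.exp_add,
      real_inner_comm x t]
    push_cast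
    rw [mul_comm Complex.I]
    ring
  simp_rw [hcongr]
  rw [integral_const_mul, h]
  have hpi : (Real.pi : ℂ) / (1 / 2) = ((2 * Real.pi : ℝ) : ℂ) := by push_cast; ring
  have hexp : ((Module.finrank ℝ E : ℂ) / 2) = (((Module.finrank ℝ E : ℝ) / 2 : ℝ) : ℂ) := by
    push_cast; ring
  rw [hpi, hexp, ← Complex.ofReal_cpow (by positivity), ← mul_assoc, ← Complex.ofReal_mul,
    ← Real.rpow_add (by positivity)]
  have : -(Module.finrank ℝ E : ℝ) / 2 + (Module.finrank ℝ E : ℝ) / 2 = 0 := by ring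
  rw [this, Real.rpow_zero, Complex.ofReal_one, one_mul, Complex.I_sq]
  congr 1
  ring

end Density

/-! ### Separation of the radial and spherical parts. -/

section Polar

variable {E : Type*} [NormedAddCommGroup E] [InnerProductSpace ℝ E] [FiniteDimensional ℝ E]
  [MeasurableSpace E] [BorelSpace E]

/-- Gaussian expectation of a positively homogeneous function in polar coordinates. -/
lemma integral_stdGaussian_of_homogeneous [Nontrivial E] {φ : E → ℝ} {k : ℕ}
    (hφ : ∀ (r : ℝ) (x : E), 0 < r → φ (r • x) = r ^ k * φ x) :
    ∫ x, φ x ∂stdGaussian E =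
      (2 * Real.pi) ^ (-(Module.finrank ℝ E : ℝ) / 2) *
        ((∫ s : Metric.sphere (0 : E) 1, φ s ∂(volume : Measure E).toSphere) *
          ∫ r in Set.Ioi (0 : ℝ), r ^ (Module.finrank ℝ E - 1 + k) *
            Real.exp (-(1 / 2) * r ^ 2)) := by
  rw [stdGaussian_eq_withDensity,
    integral_withDensity_eq_integral_smul measurable_stdGaussianDensity]
  simp_rw [NNReal.smul_def, coe_stdGaussianDensity, smul_eq_mul, mul_assoc]
  rw [integral_const_mul]
  congr 1
  let G : E → ℝ := fun x => Real.exp (-(1 / 2) * ‖x‖ ^ 2) * φ x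
  let μ : Measure E := volume
  calc
    ∫ x, G x ∂μ = ∫ x : ({(0)}ᶜ : Set E), G x ∂(μ.comap (↑)) := by
      rw [integral_subtype_comap (measurableSet_singleton _).compl G,
        restrict_compl_singleton]
    _ = ∫ p, φ p.1 * (p.2.1 ^ k * Real.exp (-(1 / 2) * p.2.1 ^ 2))
          ∂μ.toSphere.prod (.volumeIoiPow (Module.finrank ℝ E - 1)) := by
      rw [← μ.measurePreserving_homeomorphUnitSphereProd.integral_comp
        (Homeomorph.measurableEmbedding _)]
      refine integral_congr_ae (ae_of_all _ fun x => ?_)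
      have hx : 0 < ‖(x : E)‖ := norm_pos_iff.2 x.2
      have h := hφ ‖(x : E)‖ (‖(x : E)‖⁻¹ • (x : E)) hx
      rw [smul_inv_smul₀ hx.ne'] at h
      simp only [G, homeomorphUnitSphereProd_apply_snd_coe,
        homeomorphUnitSphereProd_apply_fst_coe]
      rw [h]
      ring
    _ = (∫ s, φ s ∂μ.toSphere) * ∫ r : Set.Ioi (0 : ℝ),
          r.1 ^ k * Real.exp (-(1 / 2) * r.1 ^ 2)
          ∂(.volumeIoiPow (Module.finrank ℝ E - 1)) :=
      -- This factorisation needs no integrability, so homogeneity is the only assumption on `φ`.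
      integral_prod_mul (fun s : Metric.sphere (0 : E) 1 => φ s)
        (fun r : Set.Ioi (0 : ℝ) => r.1 ^ k * Real.exp (-(1 / 2) * r.1 ^ 2))
    _ = _ := by
      congr 1
      simp only [Measure.volumeIoiPow, ENNReal.ofReal]
      rw [integral_withDensity_eq_integral_smul,
        integral_subtype_comap measurableSet_Ioi fun a =>
          Real.toNNReal (a ^ (Module.finrank ℝ E - 1)) • (a ^ k * Real.exp (-(1 / 2) * a ^ 2)),
        setIntegral_congr_fun measurableSet_Ioi fun x hx => ?_]
      · rw [NNReal.smul_def, Real.coe_toNNReal _ (pow_nonneg (le_of_lt hx) _), smul_eq_mul,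
          pow_add, mul_assoc]
      · exact (measurable_subtype_coe.pow_const _).real_toNNReal

lemma integral_pow_mul_exp_neg_half_sq (q : ℕ) :
    ∫ r in Set.Ioi (0 : ℝ), r ^ q * Real.exp (-(1 / 2) * r ^ 2) =
      (1 / 2 : ℝ) ^ (-((q : ℝ) + 1) / 2) * (1 / 2) * Real.Gamma (((q : ℝ) + 1) / 2) := by
  rw [← integral_rpow_mul_exp_neg_mul_rpow (p := 2) (q := (q : ℝ)) (b := 1 / 2) (by norm_num)
    (by have := Nat.cast_nonneg (α := ℝ) q; linarith) (by norm_num)]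
  simp

/-- Dividing a homogeneous function by the norm multiplies its Gaussian expectation by a ratio of
Gamma values. -/
lemma integral_stdGaussian_div_norm [Nontrivial E] {φ : E → ℝ} {k : ℕ}
    (hφ : ∀ (r : ℝ) (x : E), 0 < r → φ (r • x) = r ^ (k + 1) * φ x) :
    ∫ x, φ x / ‖x‖ ∂stdGaussian E =
      Real.Gamma (((Module.finrank ℝ E : ℝ) + k) / 2) /
          (√2 * Real.Gamma (((Module.finrank ℝ E : ℝ) + k + 1) / 2)) *
        ∫ x, φ x ∂stdGaussian E := by
  have hn : 1 ≤ Module.finrank ℝ E := Module.finrank_pos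
  have hφ' : ∀ (r : ℝ) (x : E), 0 < r → φ (r • x) / ‖r • x‖ = r ^ k * (φ x / ‖x‖) := by
    intro r x hr
    rw [hφ r x hr, norm_smul, Real.norm_of_nonneg hr.le, pow_succ]
    field_simp
  rw [integral_stdGaussian_of_homogeneous hφ', integral_stdGaussian_of_homogeneous hφ,
    integral_pow_mul_exp_neg_half_sq, integral_pow_mul_exp_neg_half_sq]
  -- On the unit sphere the division is invisible, so both sides share the same spherical integral.
  have hs : ∀ s : Metric.sphere (0 : E) 1, φ s / ‖(s : E)‖ = φ s := fun s => by simp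
  simp_rw [hs]
  have e1 : ((Module.finrank ℝ E - 1 + k : ℕ) : ℝ) + 1 = (Module.finrank ℝ E : ℝ) + k := by
    push_cast [hn]; ring
  have e2 : ((Module.finrank ℝ E - 1 + (k + 1) : ℕ) : ℝ) + 1
      = (Module.finrank ℝ E : ℝ) + k + 1 := by
    push_cast [hn]; ring
  rw [e1, e2]
  have hG : 0 < Real.Gamma (((Module.finrank ℝ E : ℝ) + k + 1) / 2) :=
    Real.Gamma_pos_of_pos (by positivity)
  have hp : (1 / 2 : ℝ) ^ (-((Module.finrank ℝ E : ℝ) + k + 1) / 2)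
      = (1 / 2 : ℝ) ^ (-((Module.finrank ℝ E : ℝ) + k) / 2) * √2 := by
    have : (-((Module.finrank ℝ E : ℝ) + k + 1) / 2)
      = (-((Module.finrank ℝ E : ℝ) + k) / 2) + (-(1 / 2)) := by ring
    rw [this, Real.rpow_add (by norm_num), Real.rpow_neg (by norm_num), ← Real.sqrt_eq_rpow,
      Real.sqrt_div zero_le_one, Real.sqrt_one, one_div (√2), inv_inv]
  rw [hp]
  field_simp

end Polar

lemma measurable_relu : Measurable relu := by
  unfold relu
  fun_prop

lemma relu_nonneg (t : ℝ) : 0 ≤ relu t := le_max_right _ _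

lemma relu_le_abs (t : ℝ) : relu t ≤ |t| := max_le (le_abs_self t) (abs_nonneg t)

lemma relu_mul_of_nonneg {c : ℝ} (hc : 0 ≤ c) (t : ℝ) : relu (c * t) = c * relu t := by
  rw [relu, relu, mul_max_of_nonneg _ _ hc, mul_zero]

/-! ### One-dimensional ReLU moments. -/

section Moments

lemma integral_relu_mul_pow_gaussianReal (k : ℕ) :
    ∫ t, relu t * t ^ k ∂gaussianReal 0 1 =
      (√(2 * Real.pi))⁻¹ * ∫ r in Set.Ioi (0 : ℝ), r ^ (k + 1) * Real.exp (-(1 / 2) * r ^ 2) := by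
  rw [integral_gaussianReal_eq_integral_smul one_ne_zero, ← integral_const_mul,
    ← setIntegral_eq_integral_of_forall_compl_eq_zero (s := Set.Ioi (0 : ℝ))]
  · refine setIntegral_congr_fun measurableSet_Ioi fun t ht => ?_
    have ht' : relu t = t := max_eq_left (le_of_lt ht)
    simp only [gaussianPDFReal, smul_eq_mul, ht', NNReal.coe_one, mul_one, sub_zero]
    have : -t ^ 2 / 2 = -(1 / 2) * t ^ 2 := by ring
    rw [this]
    ring
  · intro t ht
    have ht' : relu t = 0 := max_eq_right (not_lt.1 ht)
    simp [ht']

lemma integral_relu_gaussianReal :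
    ∫ t, relu t ∂gaussianReal 0 1 = (√(2 * Real.pi))⁻¹ := by
  have h := integral_relu_mul_pow_gaussianReal 0
  rw [integral_pow_mul_exp_neg_half_sq] at h
  norm_num at h
  rw [h, Real.sqrt_mul zero_le_two, mul_inv, mul_comm]

lemma integral_relu_mul_sq_gaussianReal :
    ∫ t, relu t * t ^ 2 ∂gaussianReal 0 1 = 2 * (√(2 * Real.pi))⁻¹ := by
  have h := integral_relu_mul_pow_gaussianReal 2
  rw [integral_pow_mul_exp_neg_half_sq] at h
  norm_num at h
  rw [h, Real.sqrt_mul zero_le_two, mul_inv]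
  ring

end Moments

/-! ### Linear functionals of a Gaussian vector. -/

section Inner

variable {E : Type*} [NormedAddCommGroup E] [InnerProductSpace ℝ E] [FiniteDimensional ℝ E]
  [MeasurableSpace E] [BorelSpace E]

lemma memLp_inner_stdGaussian (u : E) (p : ENNReal) (hp : p ≠ ⊤) :
    MemLp (fun x => inner ℝ u x) p (stdGaussian E) :=
  (innerSL ℝ u).comp_memLp' (IsGaussian.memLp_id (stdGaussian E) p hp)

lemma integral_inner_stdGaussian (u : E) : ∫ x, inner ℝ u x ∂stdGaussian E = 0 :=
  integral_strongDual_stdGaussian (innerSL ℝ u)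

lemma covariance_inner_stdGaussian (u v : E) :
    cov[fun x => inner ℝ u x, fun x => inner ℝ v x; stdGaussian E] = inner ℝ u v := by
  rw [← covarianceBilin_apply_eq_cov IsGaussian.memLp_two_id, covarianceBilin_stdGaussian]
  rfl

lemma variance_inner_stdGaussian (u : E) :
    Var[fun x => inner ℝ u x; stdGaussian E] = ‖u‖ ^ 2 := by
  have h := variance_dual_stdGaussian (innerSL ℝ u)
  rwa [innerSL_apply_norm] at h

lemma integral_inner_sq_stdGaussian (u : E) :
    ∫ x, (inner ℝ u x) ^ 2 ∂stdGaussian E = ‖u‖ ^ 2 := by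
  have h := variance_eq_sub (memLp_inner_stdGaussian u 2 (by norm_num))
  rw [variance_inner_stdGaussian, integral_inner_stdGaussian] at h
  simpa using h.symm

lemma hasLaw_inner_stdGaussian {u : E} (hu : ‖u‖ = 1) :
    HasLaw (fun x => inner ℝ u x) (gaussianReal 0 1) (stdGaussian E) := by
  refine ⟨by fun_prop, ?_⟩
  have h := (IsGaussian.hasGaussianLaw_id (μ := stdGaussian E)).map_fun (innerSL ℝ u)
  have h' := h.map_eq_gaussianReal
  simp only [id_eq, innerSL_apply_apply] at h'
  rw [h', integral_inner_stdGaussian, variance_inner_stdGaussian, hu]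
  simp

/-- The two functionals are jointly Gaussian and uncorrelated. -/
lemma indepFun_inner_stdGaussian {u v : E} (huv : inner ℝ u v = 0) :
    IndepFun (fun x => inner ℝ u x) (fun x => inner ℝ v x) (stdGaussian E) := by
  refine HasGaussianLaw.indepFun_of_covariance_eq_zero ?_
    (by rw [covariance_inner_stdGaussian, huv])
  exact (IsGaussian.hasGaussianLaw_id (μ := stdGaussian E)).map_fun
    ((innerSL ℝ u).prod (innerSL ℝ v))

lemma memLp_relu_inner_stdGaussian (u : E) (p : ENNReal) (hp : p ≠ ⊤) :
    MemLp (fun x => relu (inner ℝ u x)) p (stdGaussian E) :=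
  (memLp_inner_stdGaussian u p hp).mono
    (measurable_relu.comp (by fun_prop)).aestronglyMeasurable
    (ae_of_all _ fun x => by
      rw [Real.norm_of_nonneg (relu_nonneg _)]
      exact relu_le_abs _)

lemma integrable_relu_inner_mul_inner_mul_inner (u v w : E) :
    Integrable (fun x => relu (inner ℝ u x) * (inner ℝ v x * inner ℝ w x)) (stdGaussian E) := by
  have h4 : ENNReal.HolderTriple 4 4 2 := ⟨by
    rw [show (4 : ENNReal) = 2 * 2 by norm_num,
      ENNReal.mul_inv (Or.inl (by norm_num)) (Or.inl (by norm_num)), ← two_mul, ← mul_assoc,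
      ENNReal.mul_inv_cancel (by norm_num) (by norm_num), one_mul]⟩
  have h := (memLp_inner_stdGaussian w 4 (by norm_num)).mul (r := 2)
    (memLp_inner_stdGaussian v 4 (by norm_num))
  exact (memLp_relu_inner_stdGaussian u 2 (by norm_num)).integrable_mul h

/-- The Gaussian expectation of `relu ⟪u, g⟫ ⟪e, g⟫²` for a unit vector `u`. -/
lemma integral_relu_inner_mul_inner_sq_of_norm_eq_one {u : E} (hu : ‖u‖ = 1) (e : E) :
    ∫ x, relu (inner ℝ u x) * (inner ℝ e x) ^ 2 ∂stdGaussian E =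
      (√(2 * Real.pi))⁻¹ * (‖e‖ ^ 2 + (inner ℝ u e) ^ 2) := by
  set a : ℝ := inner ℝ u e with ha
  -- The component of `e` orthogonal to `u`; `⟪z, g⟫` is then independent of `⟪u, g⟫`.
  set z : E := e - a • u with hz
  have huu : inner ℝ u u = (1 : ℝ) := by rw [real_inner_self_eq_norm_sq, hu, one_pow]
  have huz : inner ℝ u z = (0 : ℝ) := by
    rw [hz, inner_sub_right, inner_smul_right, huu, ← ha]; ring
  have hzn : ‖z‖ ^ 2 = ‖e‖ ^ 2 - a ^ 2 := by
    rw [hz, norm_sub_sq_real, inner_smul_right, norm_smul, hu, real_inner_comm u e, ← ha,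
      Real.norm_eq_abs, mul_one, sq_abs]
    ring
  have hind := indepFun_inner_stdGaussian huz
  have hlaw := hasLaw_inner_stdGaussian hu
  have hexp : ∀ x, relu (inner ℝ u x) * (inner ℝ e x) ^ 2 =
      a ^ 2 * (relu (inner ℝ u x) * (inner ℝ u x * inner ℝ u x)) +
      (2 * a * (relu (inner ℝ u x) * (inner ℝ u x * inner ℝ z x)) +
        relu (inner ℝ u x) * (inner ℝ z x * inner ℝ z x)) := by
    intro x
    have : inner ℝ e x = inner ℝ z x + a * inner ℝ u x := by
      rw [hz, inner_sub_left, real_inner_smul_left]; ring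
    rw [this]; ring
  simp_rw [hexp]
  have i1 := (integrable_relu_inner_mul_inner_mul_inner u u u).const_mul (a ^ 2)
  have i2 := (integrable_relu_inner_mul_inner_mul_inner u u z).const_mul (2 * a)
  have i3 := integrable_relu_inner_mul_inner_mul_inner u z z
  have i4 : Integrable (fun x => 2 * a * (relu (inner ℝ u x) * (inner ℝ u x * inner ℝ z x)) +
      relu (inner ℝ u x) * (inner ℝ z x * inner ℝ z x)) (stdGaussian E) := i2.add i3
  rw [integral_add i1 i4, integral_add i2 i3, integral_const_mul, integral_const_mul]
  have h1 : ∫ x, relu (inner ℝ u x) * (inner ℝ u x * inner ℝ u x) ∂stdGaussian E =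
      2 * (√(2 * Real.pi))⁻¹ := by
    have hm : Measurable fun t : ℝ => relu t * t ^ 2 :=
      measurable_relu.mul (measurable_id.pow_const 2)
    rw [← integral_relu_mul_sq_gaussianReal, ← hlaw.integral_comp hm.aestronglyMeasurable]
    refine integral_congr_ae (ae_of_all _ fun x => ?_)
    simp [sq]
  -- The cross term factors by independence, and `⟪z, g⟫` has mean zero.
  have h2 : ∫ x, relu (inner ℝ u x) * (inner ℝ u x * inner ℝ z x) ∂stdGaussian E = 0 := by
    have hi := hind.comp (measurable_relu.mul measurable_id) measurable_id
    have := hi.integral_mul_eq_mul_integral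
      ((measurable_relu.mul measurable_id).comp (by fun_prop)).aestronglyMeasurable
      (measurable_id.comp (by fun_prop)).aestronglyMeasurable
    have hz0 : ∫ x, (id ∘ fun x => inner ℝ z x) x ∂stdGaussian E = 0 :=
      integral_inner_stdGaussian z
    rw [hz0, mul_zero] at this
    rw [← this]
    refine integral_congr_ae (ae_of_all _ fun x => ?_)
    simp [mul_assoc]
  have h3 : ∫ x, relu (inner ℝ u x) * (inner ℝ z x * inner ℝ z x) ∂stdGaussian E =
      (√(2 * Real.pi))⁻¹ * ‖z‖ ^ 2 := by
    have hi := hind.comp measurable_relu (measurable_id.pow_const 2)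
    have := hi.integral_mul_eq_mul_integral
      (measurable_relu.comp (by fun_prop)).aestronglyMeasurable
      ((measurable_id.pow_const 2).comp (by fun_prop)).aestronglyMeasurable
    rw [hlaw.integral_comp measurable_relu.aestronglyMeasurable,
      integral_relu_gaussianReal] at this
    have hz2 : ∫ x, ((fun t : ℝ => id t ^ 2) ∘ fun x => inner ℝ z x) x ∂stdGaussian E = ‖z‖ ^ 2 :=
      integral_inner_sq_stdGaussian z
    rw [hz2] at this
    rw [← this]
    refine integral_congr_ae (ae_of_all _ fun x => ?_)
    simp [sq]
  rw [h1, h2, h3, hzn]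
  ring

lemma integral_relu_inner_mul_inner_sq {v : E} (hv : v ≠ 0) (e : E) :
    ∫ x, relu (inner ℝ v x) * (inner ℝ e x) ^ 2 ∂stdGaussian E =
      (√(2 * Real.pi))⁻¹ * ‖v‖ * (‖e‖ ^ 2 + (inner ℝ v e) ^ 2 / ‖v‖ ^ 2) := by
  have hn : ‖v‖ ≠ 0 := norm_ne_zero_iff.2 hv
  have hu : ‖‖v‖⁻¹ • v‖ = 1 := by rw [norm_smul, norm_inv, norm_norm, inv_mul_cancel₀ hn]
  have hr : ∀ x, relu (inner ℝ v x) = ‖v‖ * relu (inner ℝ (‖v‖⁻¹ • v) x) := by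
    intro x
    rw [← relu_mul_of_nonneg (norm_nonneg v), real_inner_smul_left, mul_inv_cancel_left₀ hn]
  simp_rw [hr, mul_assoc]
  rw [integral_const_mul, integral_relu_inner_mul_inner_sq_of_norm_eq_one hu,
    real_inner_smul_left]
  field_simp

end Inner

/-! ### Weak law of large numbers. -/

section WeakLaw

variable {Ω 𝓧 : Type*} [MeasurableSpace Ω] [MeasurableSpace 𝓧] {P : Measure Ω}
  [IsProbabilityMeasure P] {ν : Measure 𝓧}

/-- The weak law of large numbers for a triangular array with pairwise independent rows. -/
lemma tendstoInMeasure_average {Y : (m : ℕ) → Fin m → Ω → 𝓧}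
    (law : ∀ m i, HasLaw (Y m i) ν P)
    (indep : ∀ m, Pairwise fun i j => IndepFun (Y m i) (Y m j) P)
    {F : 𝓧 → ℝ} (hFm : Measurable F) (hF : MemLp F 2 ν) :
    TendstoInMeasure P (fun (m : ℕ) ω => (m : ℝ)⁻¹ * ∑ i, F (Y m i ω)) atTop
      (fun _ => ∫ y, F y ∂ν) := by
  have hmem : ∀ m i, MemLp (F ∘ Y m i) 2 P := fun m i => by
    have h : MemLp F 2 (P.map (Y m i)) := by rwa [(law m i).map_eq]
    exact (memLp_map_measure_iff h.1 (law m i).aemeasurable).1 h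
  have hmean : ∀ m i, ∫ ω, (F ∘ Y m i) ω ∂P = ∫ y, F y ∂ν := fun m i =>
    (law m i).integral_comp hF.1
  have hvar : ∀ m i, Var[F ∘ Y m i; P] = Var[F; ν] := fun m i => by
    rw [← (law m i).map_eq, variance_map hFm.aemeasurable (law m i).aemeasurable]
  have hsum : ∀ m : ℕ, MemLp (fun ω => (m : ℝ)⁻¹ * ∑ i, F (Y m i ω)) 2 P := fun m =>
    (memLp_finsetSum Finset.univ fun i _ => hmem m i).const_mul _
  have hsummean : ∀ m : ℕ, m ≠ 0 →
      ∫ ω, (m : ℝ)⁻¹ * ∑ i, F (Y m i ω) ∂P = ∫ y, F y ∂ν := fun m hm => by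
    have hint : ∀ i, Integrable (fun ω => F (Y m i ω)) P := fun i =>
      (hmem m i).integrable (by norm_num)
    rw [integral_const_mul, integral_finsetSum _ fun i _ => hint i]
    have : ∀ i, ∫ ω, F (Y m i ω) ∂P = ∫ y, F y ∂ν := hmean m
    simp_rw [this]
    rw [Finset.sum_const, Finset.card_univ, Fintype.card_fin, nsmul_eq_mul,
      inv_mul_cancel_left₀ (Nat.cast_ne_zero.2 hm)]
  have hsumvar : ∀ m : ℕ, m ≠ 0 →
      Var[fun ω => (m : ℝ)⁻¹ * ∑ i, F (Y m i ω); P] = Var[F; ν] * (m : ℝ)⁻¹ := fun m hm => by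
    have h := IndepFun.variance_sum (μ := P) (s := Finset.univ) (X := fun i => F ∘ Y m i)
      (fun i _ => hmem m i) fun i _ j _ hij => (indep m hij).comp hFm hFm
    have heq : (∑ i, F ∘ Y m i) = fun ω => ∑ i, F (Y m i ω) := by
      ext ω; simp
    rw [variance_const_mul, ← heq, h]
    simp_rw [hvar]
    have : (m : ℝ) ≠ 0 := Nat.cast_ne_zero.2 hm
    rw [Finset.sum_const, Finset.card_univ, Fintype.card_fin, nsmul_eq_mul]
    field_simp
  rw [tendstoInMeasure_iff_norm]
  intro ε hε
  have hlim : Tendsto (fun m : ℕ => ENNReal.ofReal (Var[F; ν] * (m : ℝ)⁻¹ / ε ^ 2)) atTop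
      (nhds 0) := by
    have h := ((tendsto_inv_atTop_nhds_zero_nat (𝕜 := ℝ)).const_mul (Var[F; ν])).div_const (ε ^ 2)
    rw [mul_zero, zero_div] at h
    simpa using ENNReal.tendsto_ofReal h
  refine tendsto_of_tendsto_of_tendsto_of_le_of_le' tendsto_const_nhds hlim
    (Eventually.of_forall fun _ => zero_le) ?_
  -- The mean and variance formulas fail for the empty average `m = 0`; elsewhere Chebyshev applies.
  filter_upwards [eventually_ne_atTop 0] with m hm
  have h := meas_ge_le_variance_div_sq (hsum m) hε
  rwa [hsummean m hm, hsumvar m hm] at h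

end WeakLaw

/-! ### Columns as independent Gaussian vectors. -/

section Columns

variable {Ω : Type*} [MeasurableSpace Ω] {P : Measure Ω} {d m : ℕ}

/-- The `i`-th column of a `d × m` matrix as a vector of `ℝᵈ`. -/
def colVec (W : Matrix (Fin d) (Fin m) ℝ) (i : Fin m) : EuclideanSpace ℝ (Fin d) :=
  WithLp.toLp 2 (fun k => W k i)

lemma hasLaw_smul_colVec {W : Ω → Matrix (Fin d) (Fin m) ℝ} (hW : IsGaussianInit P W)
    (i : Fin m) :
    HasLaw (fun ω => √(m : ℝ) • colVec (W ω) i) (stdGaussian (EuclideanSpace ℝ (Fin d))) P := by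
  have hm : (m : ℝ) ≠ 0 := Nat.cast_ne_zero.2 (Fin.pos i).ne'
  have hlaw : ∀ k, HasLaw (fun ω => √(m : ℝ) * W ω k i) (gaussianReal 0 1) P := fun k => by
    convert! gaussianReal_const_mul (hW.law k i) (√(m : ℝ)) using 2
    · simp
    · ext
      simp [hm]
  have hind : iIndepFun (fun (k : Fin d) ω => √(m : ℝ) * W ω k i) P :=
    (hW.indep.precomp (g := fun k : Fin d => (k, i))
      (fun _ _ h => (Prod.ext_iff.1 h).1)).comp (fun _ t => √(m : ℝ) * t)
      (fun _ => measurable_const_mul _)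
  have hpi := hind.map_fun_eq_pi_map (fun k => (hlaw k).aemeasurable)
  simp_rw [fun k => (hlaw k).map_eq] at hpi
  have hmeas : AEMeasurable (fun ω (k : Fin d) => √(m : ℝ) * W ω k i) P :=
    aemeasurable_pi_lambda _ fun k => (hlaw k).aemeasurable
  have heq : (fun ω => √(m : ℝ) • colVec (W ω) i) =
      WithLp.toLp 2 ∘ fun ω (k : Fin d) => √(m : ℝ) * W ω k i := rfl
  have htoLp : Measurable (WithLp.toLp 2 : (Fin d → ℝ) → EuclideanSpace ℝ (Fin d)) := by fun_prop
  rw [heq]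
  refine ⟨htoLp.comp_aemeasurable hmeas, ?_⟩
  rw [← AEMeasurable.map_map_of_aemeasurable htoLp.aemeasurable hmeas, hpi, map_pi_eq_stdGaussian]

/-- Distinct columns are functions of disjoint blocks of the independent entries. -/
lemma indepFun_smul_colVec {W : Ω → Matrix (Fin d) (Fin m) ℝ} (hW : IsGaussianInit P W)
    (c : ℝ) {i j : Fin m} (hij : i ≠ j) :
    IndepFun (fun ω => c • colVec (W ω) i) (fun ω => c • colVec (W ω) j) P := by
  classical
  let S : Fin m → Finset (Fin d × Fin m) := fun i => Finset.univ.filter fun p => p.2 = i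
  have hmem : ∀ i k, (k, i) ∈ S i := fun i k => by simp [S]
  have hdisj : Disjoint (S i) (S j) := by
    rw [Finset.disjoint_left]
    intro p hp hq
    simp only [S, Finset.mem_filter, Finset.mem_univ, true_and] at hp hq
    exact hij (hp.symm.trans hq)
  have h := hW.indep.indepFun_finset₀ (S i) (S j) hdisj
    (fun p => (hW.law p.1 p.2).aemeasurable)
  have hmeas : ∀ i, Measurable (fun (w : S i → ℝ) =>
      (c • WithLp.toLp 2 (fun k => w ⟨(k, i), hmem i k⟩) : EuclideanSpace ℝ (Fin d))) := by
    intro i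
    fun_prop
  exact h.comp (hmeas i) (hmeas j)

end Columns

/-- The sum over the columns of a quadratically homogeneous function of Gaussian columns of
variance `1/m` converges in probability to its expectation under the standard Gaussian law. -/
lemma tendstoInMeasure_sum_colVec {Ω : Type*} [MeasurableSpace Ω] {P : Measure Ω}
    [IsProbabilityMeasure P] {d : ℕ} {W : (m : ℕ) → Ω → Matrix (Fin d) (Fin m) ℝ}
    (hW : ∀ m, IsGaussianInit P (W m)) {F : EuclideanSpace ℝ (Fin d) → ℝ} (hFm : Measurable F)
    (hF : ∀ (r : ℝ) (w : EuclideanSpace ℝ (Fin d)), 0 < r → F (r • w) = r ^ 2 * F w)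
    {C : ℝ} (hC : ∀ w, |F w| ≤ C * ‖w‖ ^ 2) :
    TendstoInMeasure P (fun m ω => ∑ i, F (colVec (W m ω) i)) atTop
      (fun _ => ∫ w, F w ∂stdGaussian (EuclideanSpace ℝ (Fin d))) := by
  have hn : MemLp (fun w : EuclideanSpace ℝ (Fin d) => ‖w‖ ^ 2) 2 (stdGaussian _) := by
    have h := IsGaussian.memLp_id (stdGaussian (EuclideanSpace ℝ (Fin d))) 4 (by norm_num)
    have h4 : ENNReal.HolderTriple 4 4 2 := ⟨by
      rw [show (4 : ENNReal) = 2 * 2 by norm_num,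
        ENNReal.mul_inv (Or.inl (by norm_num)) (Or.inl (by norm_num)), ← two_mul, ← mul_assoc,
        ENNReal.mul_inv_cancel (by norm_num) (by norm_num), one_mul]⟩
    have h' := h.norm.mul (r := 2) h.norm
    refine (memLp_congr_ae (ae_of_all _ fun w => ?_)).1 h'
    simp [sq]
  have hFL : MemLp F 2 (stdGaussian (EuclideanSpace ℝ (Fin d))) :=
    (hn.const_mul C).mono hFm.aestronglyMeasurable (ae_of_all _ fun w =>
      (hC w).trans (le_abs_self _))
  have h := tendstoInMeasure_average (fun m i => hasLaw_smul_colVec (hW m) i)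
    (fun m i j hij => indepFun_smul_colVec (hW m) _ hij) hFm hFL
  refine h.congr_left fun m => ae_of_all _ fun ω => ?_
  simp only
  rw [Finset.mul_sum]
  refine Finset.sum_congr rfl fun i _ => ?_
  have hm : (0 : ℝ) < m := Nat.cast_pos.2 (Fin.pos i)
  -- Degree 2 turns the scaling `√m` into a factor `m`, cancelling the `1/m` of the average.
  rw [hF _ _ (Real.sqrt_pos.2 hm), Real.sq_sqrt hm.le, inv_mul_cancel_left₀ hm.ne']

/-! ### The one-column summand and its expectation. -/

section Feature

variable {d : ℕ}

/-- The contribution of a column `w` to `Xᵀ ṽ⁽ᵞ⁾`. -/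
noncomputable def tildeSummand (x : EuclideanSpace ℝ (Fin d)) (γ : Fin d)
    (w : EuclideanSpace ℝ (Fin d)) : ℝ :=
  √((d : ℝ) + 2) / √2 * (relu (inner ℝ x w) * (w γ ^ 2 - ‖w‖ ^ 2 / d) / ‖w‖)

lemma network_vecTilde {m : ℕ} (W : Matrix (Fin d) (Fin m) ℝ) (x : EuclideanSpace ℝ (Fin d))
    (γ : Fin d) :
    network W x (vecTilde W γ) = ∑ i, tildeSummand x γ (colVec W i) := by
  unfold network dotProduct
  refine Finset.sum_congr rfl fun i _ => ?_
  have hd : (0 : ℝ) < d := Nat.cast_pos.2 (Fin.pos γ)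
  have hin : inner ℝ x (colVec W i) = (x.ofLp ᵥ* W) i := by
    simp [PiLp.inner_apply, colVec, Matrix.vecMul, dotProduct, mul_comm]
  have hsq : √((d : ℝ) + 2) / √(d : ℝ) * (‖colVec W i‖ / √(d : ℝ)) =
      √((d : ℝ) + 2) * (‖colVec W i‖ / d) := by
    rw [div_mul_div_comm, Real.mul_self_sqrt hd.le, mul_div_assoc]
  -- This also holds at norm zero, by the convention `0 / 0 = 0`.
  have hnorm : ‖colVec W i‖ = ‖colVec W i‖ ^ 2 / ‖colVec W i‖ := by
    rcases eq_or_ne ‖colVec W i‖ 0 with h | h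
    · simp [h]
    · field_simp
  have hcol : colNorm W i = ‖colVec W i‖ := rfl
  have hγ : (colVec W i) γ = W γ i := rfl
  simp only [covariate, vecTilde, vecPair, vecZero, Pi.smul_apply, Pi.sub_apply, smul_eq_mul,
    tildeSummand, hin, hcol, hγ]
  rw [Real.sqrt_div (by positivity), hsq]
  conv_lhs => rw [show ‖colVec W i‖ / (d : ℝ) = ‖colVec W i‖ ^ 2 / ‖colVec W i‖ / d by
    rw [← hnorm]]
  ring

lemma network_vecThird {m : ℕ} (hd : 0 < d) (W : Matrix (Fin d) (Fin m) ℝ)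
    (x : EuclideanSpace ℝ (Fin d)) (γ : Fin d) :
    network W x (vecThird hd W γ) = ∑ i, (tildeSummand x γ (colVec W i) -
      1 / (√(d : ℝ) + 1) * tildeSummand x (lastIdx hd) (colVec W i)) := by
  rw [Finset.sum_sub_distrib, ← Finset.mul_sum, ← network_vecTilde, ← network_vecTilde]
  simp only [network, vecThird, dotProduct_sub, dotProduct_smul, smul_eq_mul]

lemma measurable_tildeSummand (x : EuclideanSpace ℝ (Fin d)) (γ : Fin d) :
    Measurable (tildeSummand x γ) := by
  unfold tildeSummand
  have := measurable_relu
  fun_prop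

lemma tildeSummand_smul (x : EuclideanSpace ℝ (Fin d)) (γ : Fin d) {r : ℝ}
    (w : EuclideanSpace ℝ (Fin d)) (hr : 0 < r) :
    tildeSummand x γ (r • w) = r ^ 2 * tildeSummand x γ w := by
  simp only [tildeSummand, inner_smul_right, relu_mul_of_nonneg hr.le, norm_smul,
    Real.norm_of_nonneg hr.le, PiLp.smul_apply, smul_eq_mul]
  field_simp

lemma abs_tildeSummand_le (x : EuclideanSpace ℝ (Fin d)) (γ : Fin d)
    (w : EuclideanSpace ℝ (Fin d)) :
    |tildeSummand x γ w| ≤ √((d : ℝ) + 2) / √2 * ‖x‖ * ‖w‖ ^ 2 := by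
  have hd : (1 : ℝ) ≤ d := Nat.one_le_cast.2 (Fin.pos γ)
  have h1 : relu (inner ℝ x w) ≤ ‖x‖ * ‖w‖ := (relu_le_abs _).trans (abs_real_inner_le_norm x w)
  have h2 : |w γ ^ 2 - ‖w‖ ^ 2 / d| ≤ ‖w‖ ^ 2 := by
    have hγ : w γ ^ 2 ≤ ‖w‖ ^ 2 := by
      rw [← sq_abs, ← Real.norm_eq_abs]
      exact pow_le_pow_left₀ (norm_nonneg _) (PiLp.norm_apply_le w γ) 2
    have hw : ‖w‖ ^ 2 / d ≤ ‖w‖ ^ 2 := div_le_self (by positivity) hd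
    have hw' : 0 ≤ ‖w‖ ^ 2 / d := by positivity
    rw [abs_le]
    constructor <;> nlinarith [sq_nonneg (w γ)]
  rw [tildeSummand, abs_mul, abs_of_nonneg (by positivity), mul_assoc, abs_div, abs_mul,
    abs_of_nonneg (relu_nonneg _), abs_norm]
  refine mul_le_mul_of_nonneg_left ?_ (by positivity)
  rcases eq_or_ne ‖w‖ 0 with h | h
  · simp [h]
  · rw [div_le_iff₀ (lt_of_le_of_ne (norm_nonneg _) h.symm)]
    calc relu (inner ℝ x w) * |w γ ^ 2 - ‖w‖ ^ 2 / d| ≤ (‖x‖ * ‖w‖) * ‖w‖ ^ 2 :=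
          mul_le_mul h1 h2 (abs_nonneg _) (by positivity)
      _ = ‖x‖ * ‖w‖ ^ 2 * ‖w‖ := by ring

lemma integrable_relu_inner_mul_sq_apply (x : EuclideanSpace ℝ (Fin d)) (γ : Fin d) :
    Integrable (fun w : EuclideanSpace ℝ (Fin d) => relu (inner ℝ x w) * w γ ^ 2)
      (stdGaussian _) := by
  have h := integrable_relu_inner_mul_inner_mul_inner x (EuclideanSpace.single γ (1 : ℝ))
    (EuclideanSpace.single γ (1 : ℝ))
  simpa [EuclideanSpace.inner_single_left, ← sq] using h

lemma integral_relu_inner_mul_sq_apply {x : EuclideanSpace ℝ (Fin d)} (hx : x ≠ 0) (γ : Fin d) :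
    ∫ w, relu (inner ℝ x w) * w γ ^ 2 ∂stdGaussian (EuclideanSpace ℝ (Fin d)) =
      (√(2 * Real.pi))⁻¹ * ‖x‖ * (1 + ratio x γ) := by
  have h := integral_relu_inner_mul_inner_sq hx (EuclideanSpace.single γ (1 : ℝ))
  simpa [EuclideanSpace.inner_single_left, EuclideanSpace.inner_single_right, ratio] using h

lemma sum_ratio {x : EuclideanSpace ℝ (Fin d)} (hx : x ≠ 0) : ∑ γ, ratio x γ = 1 := by
  have hn : ‖x‖ ^ 2 ≠ 0 := pow_ne_zero 2 (norm_ne_zero_iff.2 hx)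
  simp only [ratio]
  rw [← Finset.sum_div, ← EuclideanSpace.real_norm_sq_eq, div_self hn]

/-- Expanding `‖w‖²` into coordinates and using that the ratios sum to 1 leaves `(1 + r_γ) - (d + 1)
/ d`. -/
lemma integral_relu_inner_mul_sq_sub {x : EuclideanSpace ℝ (Fin d)} (hx : x ≠ 0) (γ : Fin d) :
    ∫ w, relu (inner ℝ x w) * (w γ ^ 2 - ‖w‖ ^ 2 / d)
        ∂stdGaussian (EuclideanSpace ℝ (Fin d)) =
      (√(2 * Real.pi))⁻¹ * ‖x‖ * (ratio x γ - 1 / d) := by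
  have hd : (d : ℝ) ≠ 0 := Nat.cast_ne_zero.2 (Fin.pos γ).ne'
  have hexp : ∀ w : EuclideanSpace ℝ (Fin d), relu (inner ℝ x w) * (w γ ^ 2 - ‖w‖ ^ 2 / d) =
      relu (inner ℝ x w) * w γ ^ 2 - (d : ℝ)⁻¹ * ∑ k, relu (inner ℝ x w) * w k ^ 2 := by
    intro w
    rw [← Finset.mul_sum, ← EuclideanSpace.real_norm_sq_eq]
    ring
  simp_rw [hexp]
  rw [integral_sub (integrable_relu_inner_mul_sq_apply x γ)
      ((integrable_finsetSum _ fun k _ => integrable_relu_inner_mul_sq_apply x k).const_mul _),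
    integral_const_mul, integral_finsetSum _ fun k _ => integrable_relu_inner_mul_sq_apply x k]
  simp_rw [integral_relu_inner_mul_sq_apply hx]
  rw [← Finset.mul_sum, Finset.sum_add_distrib, sum_ratio hx]
  simp only [Finset.sum_const, Finset.card_univ, Fintype.card_fin, nsmul_eq_mul]
  field_simp
  ring

lemma integrable_tildeSummand (x : EuclideanSpace ℝ (Fin d)) (γ : Fin d) :
    Integrable (tildeSummand x γ) (stdGaussian _) := by
  have h := (IsGaussian.memLp_two_id (μ := stdGaussian (EuclideanSpace ℝ (Fin d)))).norm
  refine (h.integrable_sq.const_mul (√((d : ℝ) + 2) / √2 * ‖x‖)).mono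
    (measurable_tildeSummand x γ).aestronglyMeasurable (ae_of_all _ fun w => ?_)
  exact (abs_tildeSummand_le x γ w).trans (le_abs_self _)

/-- The Gamma-function ratio produced by the radial integrals, in terms of the Beta function. -/
lemma gamma_ratio_eq_beta {a : ℝ} (ha : 0 < a) :
    Real.Gamma ((a + 2) / 2) / (√2 * Real.Gamma ((a + 2 + 1) / 2)) * (√(2 * Real.pi))⁻¹ =
      a / (2 * Real.pi * (a + 1)) * beta (a / 2) (1 / 2) := by
  have e1 : (a + 2) / 2 = a / 2 + 1 := by ring
  have e2 : (a + 2 + 1) / 2 = (a / 2 + 1 / 2) + 1 := by ring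
  have hG : 0 < Real.Gamma (a / 2 + 1 / 2) := Real.Gamma_pos_of_pos (by positivity)
  have hpi : √Real.pi * √Real.pi = Real.pi := Real.mul_self_sqrt Real.pi_pos.le
  have h2 : √2 * √2 = (2 : ℝ) := Real.mul_self_sqrt zero_le_two
  have hp : 0 < √Real.pi := Real.sqrt_pos.2 Real.pi_pos
  rw [e1, e2, Real.Gamma_add_one (by positivity), Real.Gamma_add_one (by positivity), beta,
    Real.Gamma_one_half_eq, Real.sqrt_mul zero_le_two]
  generalize Real.Gamma (a / 2 + 1 / 2) = G at *
  generalize Real.Gamma (a / 2) = H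
  have h2' : 0 < √2 := by positivity
  generalize √Real.pi = p at *
  rw [← hpi]
  have : (2 : ℝ) * (p * p) * (a + 1) = (√2 * √2) * (p * p) * (a + 1) := by rw [h2]
  rw [this]
  field_simp

lemma integral_tildeSummand {x : EuclideanSpace ℝ (Fin d)} (hx : x ≠ 0) (γ : Fin d) :
    ∫ w, tildeSummand x γ w ∂stdGaussian (EuclideanSpace ℝ (Fin d)) =
      (d : ℝ) * √((d : ℝ) + 2) / (2 * Real.pi * ((d : ℝ) + 1) * √2)
        * beta ((d : ℝ) / 2) (1 / 2) * ‖x‖ * (ratio x γ - 1 / (d : ℝ)) := by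
  have hd : (0 : ℝ) < d := Nat.cast_pos.2 (Fin.pos γ)
  have : Nontrivial (EuclideanSpace ℝ (Fin d)) := nontrivial_of_ne x 0 hx
  have hQ : ∀ (r : ℝ) (w : EuclideanSpace ℝ (Fin d)), 0 < r →
      relu (inner ℝ x (r • w)) * ((r • w) γ ^ 2 - ‖r • w‖ ^ 2 / d) =
        r ^ (2 + 1) * (relu (inner ℝ x w) * (w γ ^ 2 - ‖w‖ ^ 2 / d)) := by
    intro r w hr
    simp only [inner_smul_right, relu_mul_of_nonneg hr.le, norm_smul,
      Real.norm_of_nonneg hr.le, PiLp.smul_apply, smul_eq_mul]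
    ring
  have h := integral_stdGaussian_div_norm (k := 2)
    (φ := fun w : EuclideanSpace ℝ (Fin d) => relu (inner ℝ x w) * (w γ ^ 2 - ‖w‖ ^ 2 / d)) hQ
  simp only [tildeSummand]
  rw [integral_const_mul, h, integral_relu_inner_mul_sq_sub hx, finrank_euclideanSpace_fin]
  have hb := gamma_ratio_eq_beta hd
  push_cast
  calc _ = √((d : ℝ) + 2) / √2 * (Real.Gamma (((d : ℝ) + 2) / 2) /
          (√2 * Real.Gamma (((d : ℝ) + 2 + 1) / 2)) * (√(2 * Real.pi))⁻¹) * ‖x‖ *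
          (ratio x γ - 1 / d) := by ring
    _ = _ := by
      rw [hb]
      field_simp

end Feature

/-! ### Limits in probability of the network. -/

section Limits

variable {Ω : Type*} [MeasurableSpace Ω] {P : Measure Ω} [IsProbabilityMeasure P] {d : ℕ}
  {W : (m : ℕ) → Ω → Matrix (Fin d) (Fin m) ℝ}

lemma tendstoInMeasure_network_vecTilde (hW : ∀ m, IsGaussianInit P (W m))
    {x : EuclideanSpace ℝ (Fin d)} (hx : x ≠ 0) (γ : Fin d) :
    TendstoInMeasure P (fun m ω => network (W m ω) x (vecTilde (W m ω) γ)) atTop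
      (fun _ => (d : ℝ) * √((d : ℝ) + 2) / (2 * Real.pi * ((d : ℝ) + 1) * √2)
        * beta ((d : ℝ) / 2) (1 / 2) * ‖x‖ * (ratio x γ - 1 / (d : ℝ))) := by
  have h := tendstoInMeasure_sum_colVec hW (measurable_tildeSummand x γ)
    (fun _ w hr => tildeSummand_smul x γ w hr) (abs_tildeSummand_le x γ)
  simp_rw [← network_vecTilde, integral_tildeSummand hx] at h
  exact h

lemma tendstoInMeasure_network_vecThird (hW : ∀ m, IsGaussianInit P (W m))
    {x : EuclideanSpace ℝ (Fin d)} (hx : x ≠ 0) (hd : 0 < d) (γ : Fin d) :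
    TendstoInMeasure P (fun m ω => network (W m ω) x (vecThird hd (W m ω) γ)) atTop
      (fun _ => (d : ℝ) * √((d : ℝ) + 2) / (2 * Real.pi * ((d : ℝ) + 1) * √2)
        * beta ((d : ℝ) / 2) (1 / 2) * ‖x‖
        * (ratio x γ - 1 / (√(d : ℝ) + 1) * ratio x (lastIdx hd)
          - 1 / ((d : ℝ) + √(d : ℝ)))) := by
  set c : ℝ := 1 / (√(d : ℝ) + 1) with hc
  set K : ℝ := √((d : ℝ) + 2) / √2 * ‖x‖ with hK
  have hc0 : 0 ≤ c := by positivity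
  -- The law is applied once to the combined summand, so no limits in probability have to be
  -- subtracted.
  have h := tendstoInMeasure_sum_colVec hW
    (F := fun w => tildeSummand x γ w - c * tildeSummand x (lastIdx hd) w)
    ((measurable_tildeSummand x γ).sub ((measurable_tildeSummand x (lastIdx hd)).const_mul c))
    (fun r w hr => by
      rw [tildeSummand_smul x γ w hr, tildeSummand_smul x _ w hr]; ring)
    (C := K + c * K) (fun w => by
      calc _ ≤ |tildeSummand x γ w| + |c * tildeSummand x (lastIdx hd) w| := abs_sub _ _
        _ ≤ K * ‖w‖ ^ 2 + c * (K * ‖w‖ ^ 2) := by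
          rw [abs_mul, abs_of_nonneg hc0]
          exact add_le_add (abs_tildeSummand_le x γ w)
            (mul_le_mul_of_nonneg_left (abs_tildeSummand_le x _ w) hc0)
        _ = (K + c * K) * ‖w‖ ^ 2 := by ring)
  rw [integral_sub (integrable_tildeSummand x γ) ((integrable_tildeSummand x _).const_mul c),
    integral_const_mul, integral_tildeSummand hx, integral_tildeSummand hx] at h
  simp_rw [hc, ← network_vecThird] at h
  convert! h using 2
  have hd' : (0 : ℝ) < d := Nat.cast_pos.2 hd
  have hs : √(d : ℝ) * √(d : ℝ) = d := Real.mul_self_sqrt hd'.le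
  have hs0 : 0 < √(d : ℝ) := Real.sqrt_pos.2 hd'
  -- Since `1 - c = √d / (√d + 1)`, the two `1/d` terms merge into the stated constant.
  have key : 1 / ((d : ℝ) + √(d : ℝ)) = 1 / d - c * (1 / d) := by
    rw [hc]
    generalize √(d : ℝ) = s at hs hs0 ⊢
    rw [← hs]
    field_simp
    ring
  rw [key]
  ring

end Limits

end ReluFeature

theorem mainTheorem3 :
    ∃ C : ℝ, ∀ (d : ℕ) (hd : 6 ≤ d), ∃ h : Fin d → ℝ → ℝ → ℝ,
      (∀ (γ : Fin d) (s r : ℝ), 0 < s → 0 ≤ r → r ≤ 1 → |h γ s r| ≤ C * (r ^ 2 * s)) ∧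
      ∀ (Ω : Type*) [MeasurableSpace Ω] (P : Measure Ω) [IsProbabilityMeasure P]
        (W : (m : ℕ) → Ω → Matrix (Fin d) (Fin m) ℝ), (∀ m, IsGaussianInit P (W m)) →
      ∀ x : EuclideanSpace ℝ (Fin d), x ≠ 0 →
        (∀ γ : Fin d,
          ((∀ i, i ≠ γ → x i = 0) →
            TendstoInMeasure P (fun m ω => network (W m ω) x (vecTilde (W m ω) γ)) atTop
              (fun _ => ((d : ℝ) - 1) * √((d : ℝ) + 2) / (2 * Real.pi * ((d : ℝ) + 1) * √2)
                * beta ((d : ℝ) / 2) (1 / 2) * ‖x‖)) ∧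
          (x γ = 0 →
            TendstoInMeasure P (fun m ω => network (W m ω) x (vecTilde (W m ω) γ)) atTop
              (fun _ => -(√((d : ℝ) + 2) / (2 * Real.pi * ((d : ℝ) + 1) * √2))
                * beta ((d : ℝ) / 2) (1 / 2) * ‖x‖)) ∧
          (x γ ≠ 0 → (∃ i, i ≠ γ ∧ x i ≠ 0) →
            TendstoInMeasure P (fun m ω => network (W m ω) x (vecTilde (W m ω) γ)) atTop
              (fun _ => (d : ℝ) * √((d : ℝ) + 2) / (2 * Real.pi * ((d : ℝ) + 1) * √2)
                * beta ((d : ℝ) / 2) (1 / 2) * ‖x‖ * (ratio x γ - 1 / (d : ℝ))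
                + h γ ‖x‖ (ratio x γ)))) ∧
        (∀ γ : Fin d, γ ≠ lastIdx (show 0 < d by omega) →
          TendstoInMeasure P
            (fun m ω => network (W m ω) x (vecThird (show 0 < d by omega) (W m ω) γ)) atTop
            (fun _ => (d : ℝ) * √((d : ℝ) + 2) / (2 * Real.pi * ((d : ℝ) + 1) * √2)
              * beta ((d : ℝ) / 2) (1 / 2) * ‖x‖
              * (ratio x γ - 1 / (√(d : ℝ) + 1) * ratio x (lastIdx (show 0 < d by omega))
                - 1 / ((d : ℝ) + √(d : ℝ)))
              + h γ ‖x‖ (ratio x γ)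
              - 1 / (√(d : ℝ) + 1)
                * h (lastIdx (show 0 < d by omega)) ‖x‖
                    (ratio x (lastIdx (show 0 < d by omega))))) := by
  -- The limit is exactly affine in `ratio x γ`, which forces the correction terms to be zero on
  -- `0 < r < 1`; the zero function serves for all `r`.
  refine ⟨0, fun d hd => ⟨fun _ _ _ => 0, fun γ s r _ _ _ => by simp, ?_⟩⟩
  intro Ω _ P _ W hW x hx
  have hd0 : (d : ℝ) ≠ 0 := Nat.cast_ne_zero.2 (by omega)
  refine ⟨fun γ => ?_, fun γ _ => ?_⟩
  · have h := tendstoInMeasure_network_vecTilde hW hx γ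
    refine ⟨fun hγ => ?_, fun hγ => ?_, fun _ _ => ?_⟩
    -- All other ratios vanish and the total is 1.
    · have hr : ratio x γ = 1 := by
        rw [← sum_ratio hx, Finset.sum_eq_single γ (fun i _ hi => by simp [ratio, hγ i hi])
          (fun h => absurd (Finset.mem_univ γ) h)]
      rw [hr] at h
      convert! h using 2
      field_simp
    · have hr : ratio x γ = 0 := by simp [ratio, hγ]
      rw [hr] at h
      convert! h using 2
      field_simp
      ring
    · simpa using h
  · simpa using tendstoInMeasure_network_vecThird hW hx (by omega) γ
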